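/- For integers $n\ge 1$, $k\ge 1$ and $m\ge 2$, let $P_n$ be the path on $n$ vertices, let $kP_n$ be the disjoint union of $k$ copies of $P_n$, and let the Jahangir graph $J_{2m}$ be the graph on $2m+1$ vertices consisting of a cycle $C_{2m}$ together with one additional vertex adjacent to $m$ alternate vertices of the cycle. For graphs $G$ and $H$, the Ramsey number $R(G,H)$ is the least natural number $r$ such that for every graph $F$ of order $r$, either $F$ contains $G$ or the complement of $F$ contains $H$ (as a not necessarily induced subgraph). **Theorem 3.** Let $k\ge 2$, $m$ and $n$ be integers such that either $m\in\{3,4,5\}$ and $n\ge 2m+1$, or $m\ge 6$ and $n\ge (4m-1)(m-1)+1$. Then $$R(kP_n,J_{2m})=kn+m-1.$$ -/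

import Mathlib

/-- The Jahangir graph `J_{2m}`: the cycle `C_{2m}` on the vertices `some 0, …, some (2m - 1)`,
together with one additional vertex `none` that is adjacent to every second vertex
`some 0, some 2, …, some (2m - 2)` of the cycle. -/
def jahangirGraph (m : ℕ) : SimpleGraph (Option (Fin (2 * m))) where
  Adj
    | some i, some j => (SimpleGraph.cycleGraph (2 * m)).Adj i j
    | none, some j => Even j.val
    | some i, none => Even i.val
    | none, none => False
  symm.symm
    | some _, some _ => fun h => h.symm
    | none, some _ => id
    | some _, none => id
    | none, none => id
  loopless.irrefl
    | some _ => (SimpleGraph.cycleGraph (2 * m)).irrefl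
    | none => id

/-- The graph `kG`: the disjoint union of `k` copies of `G`. -/
def disjointCopies {V : Type*} (k : ℕ) (G : SimpleGraph V) : SimpleGraph (Fin k × V) where
  Adj a b := a.1 = b.1 ∧ G.Adj a.2 b.2
  symm.symm _ _ h := ⟨h.1.symm, h.2.symm⟩
  loopless.irrefl _ h := G.irrefl h.2

/-- `IsRamseyNumber G H N` says that `R(G, H) = N`: the number `N` is the least natural number `r`
such that every graph `F` of order `r` contains `G`, or its complement contains `H`, as a (not
necessarily induced) subgraph. -/
def IsRamseyNumber {V W : Type*} (G : SimpleGraph V) (H : SimpleGraph W) (N : ℕ) : Prop :=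
  IsLeast {r : ℕ | ∀ F : SimpleGraph (Fin r), G.IsContained F ∨ H.IsContained Fᶜ} N

/-! For the lower bound, take a clique on `kn - 1` vertices plus at most `m - 1` isolated ones. The
clique is too small for `kP_n`. It is independent in the complement, where a `J_{2m}` would need a
vertex outside it on each of `m` disjoint cycle edges.

For the upper bound, a path on `N = kn` vertices already contains `kP_n`, and both parameter ranges
give `N ≥ 4m + 2`, so it suffices to treat a single path. If a graph on `N + m - 1` vertices has no
such path, at least `m` vertices `u i` lie off a longest path `l`. There are three cases. If `l` is
short, depth-first search gives two large sets with no edges between them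
(`exists_card_eq_forall_not_adj`). If `l` is long and every `u i` has few neighbours on it, the `u
i` become the even cycle vertices and the first vertex of `l` the centre. If some `u i` has many
neighbours on `l`, their successors form a large independent set
(`IsLongestPath.exists_independent`), which supplies the even vertices and the centre. -/

/-! ### Embedding criteria for the Jahangir graph. -/

theorem val_finRotate {m : ℕ} (i : Fin m) : (finRotate m i : ℕ) = (i + 1) % m := by
  cases m with
  | zero => exact i.elim0
  | succ m =>
    have hi := i.isLt
    rw [coe_finRotate]
    split_ifs with h
    · simp [h]
    · rw [Fin.ext_iff, Fin.val_last] at h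
      rw [Nat.mod_eq_of_lt (by omega)]

theorem cycleGraph_adj_cases {n : ℕ} {i j : Fin n} (h : (SimpleGraph.cycleGraph n).Adj i j) :
    (j : ℕ) = (i + 1) % n ∨ (i : ℕ) = (j + 1) % n := by
  have key : ∀ a b : Fin n, (a - b).val = 1 → (a : ℕ) = (b + 1) % n := by
    intro a b hab
    have ha := a.isLt
    have hb := b.isLt
    rw [Fin.val_sub] at hab
    rcases le_or_gt (b : ℕ) a with h1 | h1
    · rw [show n - (b : ℕ) + a = (a - b) + n by omega, Nat.add_mod_right,
        Nat.mod_eq_of_lt (by omega)] at hab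
      rw [Nat.mod_eq_of_lt (by omega)]
      omega
    · rw [Nat.mod_eq_of_lt (by omega)] at hab
      rw [show (b : ℕ) + 1 = n by omega, Nat.mod_self]
      omega
  rw [SimpleGraph.cycleGraph_adj'] at h
  exact h.symm.imp (key j i) (key i j)

/-- The Jahangir graph embeds as soon as there are images `f` of the even cycle vertices, `g` of
the odd cycle vertices and `c` of the centre. -/
theorem jahangirGraph_isContained {V : Type*} {H : SimpleGraph V} {m : ℕ} {f g : Fin m → V} {c : V}
    (hf : Function.Injective f) (hg : Function.Injective g) (hfg : ∀ i j, f i ≠ g j)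
    (hcg : ∀ i, c ≠ g i) (hcf : ∀ i, H.Adj c (f i)) (h0 : ∀ i, H.Adj (f i) (g i))
    (h1 : ∀ i, H.Adj (g i) (f (finRotate m i))) :
    (jahangirGraph m).IsContained H := by
  let e : Fin (2 * m) → Fin m := fun j => ⟨j / 2, by have := j.isLt; omega⟩
  let φ : Option (Fin (2 * m)) → V := fun o => match o with
    | none => c
    | some j => if Even j.val then f (e j) else g (e j)
  have hstep : ∀ i j : Fin (2 * m), (j : ℕ) = (i + 1) % (2 * m) → H.Adj (φ (some i)) (φ (some j)) := by
    intro i j hij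
    have hi := i.isLt
    have hj := j.isLt
    by_cases hev : Even i.val
    · have hev' := hev
      rw [Nat.even_iff] at hev'
      rw [Nat.mod_eq_of_lt (by omega)] at hij
      have hodd : ¬ Even j.val := by rw [Nat.even_iff]; omega
      have hee : e j = e i := by ext; simp only [e]; omega
      simp only [φ, hev, hodd, if_true, if_false, hee]
      exact h0 _
    · have hev' := hev
      rw [Nat.even_iff] at hev'
      have hodd : Even j.val ∧ e j = finRotate m (e i) := by
        rw [Nat.even_iff, Fin.ext_iff, val_finRotate]
        simp only [e]
        rcases Nat.lt_or_ge (i.val + 1) (2 * m) with hlt | hge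
        · rw [Nat.mod_eq_of_lt hlt] at hij
          rw [Nat.mod_eq_of_lt (show i.val / 2 + 1 < m by omega)]
          omega
        · rw [show i.val + 1 = 2 * m by omega, Nat.mod_self] at hij
          rw [show i.val / 2 + 1 = m by omega, Nat.mod_self]
          omega
      simp only [φ, hev, hodd.1, if_true, if_false, hodd.2]
      exact h1 _
  have hadj : ∀ {a b}, (jahangirGraph m).Adj a b → H.Adj (φ a) (φ b) := by
    intro a b hab
    match a, b, hab with
    | some i, some j, hab =>
      rcases cycleGraph_adj_cases hab with h | h
      · exact hstep i j h
      · exact (hstep j i h).symm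
    | none, some j, hab =>
      have hab : Even j.val := hab
      simp only [φ, hab, if_true]
      exact hcf _
    | some j, none, hab =>
      have hab : Even j.val := hab
      simp only [φ, hab, if_true]
      exact (hcf _).symm
  have hc : ∀ j, c ≠ φ (some j) := by
    intro j
    simp only [φ]
    split_ifs
    · exact (hcf _).ne
    · exact hcg _
  refine ⟨⟨⟨φ, hadj⟩, ?_⟩⟩
  intro a b hab
  replace hab : φ a = φ b := hab
  match a, b, hab with
  | none, none, _ => rfl
  | none, some j, hab => exact absurd hab (hc j)
  | some j, none, hab => exact absurd hab.symm (hc j)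
  | some i, some j, hab =>
    congr 1
    simp only [φ] at hab
    ext
    split_ifs at hab with h2 h3 h3
    · have := congrArg Fin.val (hf hab)
      simp only [e] at this
      rw [Nat.even_iff] at h2 h3
      omega
    · exact absurd hab (hfg _ _)
    · exact absurd hab.symm (hfg _ _)
    · have := congrArg Fin.val (hg hab)
      simp only [e] at this
      rw [Nat.even_iff] at h2 h3
      omega

/-- Hall's condition holds because any single `T i` already has `m` elements. -/
theorem exists_injective_mem_of_card_le {V : Type*} [DecidableEq V] {m : ℕ} (T : Fin m → Finset V)
    (hT : ∀ i, m ≤ (T i).card) : ∃ f : Fin m → V, Function.Injective f ∧ ∀ i, f i ∈ T i := by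
  rw [← Finset.all_card_le_biUnion_card_iff_exists_injective]
  intro s
  rcases s.eq_empty_or_nonempty with rfl | ⟨i, hi⟩
  · simp
  · calc s.card ≤ m := by simpa using s.card_le_univ
      _ ≤ (T i).card := hT i
      _ ≤ _ := Finset.card_le_card (Finset.subset_biUnion_of_mem T hi)

open Classical in
/-- Vertices `u i` with few neighbours in a large set `Q` serve as the even cycle vertices. -/
theorem jahangirGraph_isContained_compl_of_few_neighbors {V : Type*} {G : SimpleGraph V}
    {m D : ℕ} {u : Fin m → V} {c : V} {Q : Finset V} (hu : Function.Injective u)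
    (huQ : ∀ i, u i ∉ Q) (hcQ : c ∉ Q) (hcu : ∀ i, c ≠ u i ∧ ¬ G.Adj c (u i))
    (hD : ∀ i, (Q.filter (G.Adj (u i))).card ≤ D) (hQ : m + 2 * D ≤ Q.card) :
    (jahangirGraph m).IsContained Gᶜ := by
  let N : Fin m → Finset V := fun i => Q.filter (G.Adj (u i))
  -- Each odd vertex must avoid the neighbours of its two cycle neighbours, at most `2 * D` vertices
  -- of `Q`, which leaves `m` choices.
  obtain ⟨g, hg, hgT⟩ := exists_injective_mem_of_card_le
    (fun i => Q \ (N i ∪ N (finRotate m i))) (by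
      intro i
      have h1 := Finset.le_card_sdiff (N i ∪ N (finRotate m i)) Q
      have h2 := Finset.card_union_le (N i) (N (finRotate m i))
      have h3 : (N i).card ≤ D := hD i
      have h4 : (N (finRotate m i)).card ≤ D := hD _
      omega)
  have hmem : ∀ i, g i ∈ Q ∧ ¬ G.Adj (u i) (g i) ∧ ¬ G.Adj (u (finRotate m i)) (g i) := by
    intro i
    have := hgT i
    simp only [N, Finset.mem_sdiff, Finset.mem_union, Finset.mem_filter] at this
    tauto
  have hne : ∀ i j, u i ≠ g j := fun i j h => huQ i (h ▸ (hmem j).1)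
  refine jahangirGraph_isContained (c := c) hu hg hne (fun i h => hcQ (h ▸ (hmem i).1)) ?_ ?_ ?_
  · exact fun i => (SimpleGraph.compl_adj ..).2 (hcu i)
  · exact fun i => (SimpleGraph.compl_adj ..).2 ⟨hne _ _, (hmem i).2.1⟩
  · exact fun i => (SimpleGraph.compl_adj ..).2
      ⟨(hne _ _).symm, fun h => (hmem i).2.2 h.symm⟩

open Classical in
/-- Vertices `u i` with at most one neighbour each in a large independent set `Q` serve as the odd
cycle vertices. -/
theorem jahangirGraph_isContained_compl_of_independent {V : Type*} {G : SimpleGraph V}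
    {m : ℕ} {u : Fin m → V} {Q : Finset V} (hu : Function.Injective u)
    (huQ : ∀ i, u i ∉ Q) (hind : ∀ x ∈ Q, ∀ y ∈ Q, ¬ G.Adj x y)
    (hD : ∀ i, (Q.filter (G.Adj (u i))).card ≤ 1) (hQ : m + 2 ≤ Q.card) :
    (jahangirGraph m).IsContained Gᶜ := by
  let N : Fin m → Finset V := fun i => Q.filter (G.Adj (u i))
  obtain ⟨f, hf, hfT⟩ := exists_injective_mem_of_card_le
    (fun i => Q \ (N i ∪ N ((finRotate m).symm i))) (by
      intro i
      have h1 := Finset.le_card_sdiff (N i ∪ N ((finRotate m).symm i)) Q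
      have h2 := Finset.card_union_le (N i) (N ((finRotate m).symm i))
      have h3 : (N i).card ≤ 1 := hD i
      have h4 : (N ((finRotate m).symm i)).card ≤ 1 := hD _
      omega)
  have hmem : ∀ i, f i ∈ Q ∧ ¬ G.Adj (u i) (f i) ∧ ¬ G.Adj (u ((finRotate m).symm i)) (f i) := by
    intro i
    have := hfT i
    simp only [N, Finset.mem_sdiff, Finset.mem_union, Finset.mem_filter] at this
    tauto
  -- Independence of `Q` lets any vertex of it not used by `f` be the centre.
  obtain ⟨c, hcQ, hcf⟩ : ∃ c ∈ Q, c ∉ Finset.univ.image f := by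
    apply Finset.exists_mem_notMem_of_card_lt_card
    have : (Finset.univ.image f).card ≤ m := by
      simpa using Finset.card_image_le (s := Finset.univ) (f := f)
    omega
  have hne : ∀ i j, f i ≠ u j := fun i j h => huQ j (h ▸ (hmem i).1)
  refine jahangirGraph_isContained (c := c) hf hu hne (fun i h => huQ i (h ▸ hcQ)) ?_ ?_ ?_
  · refine fun i => (SimpleGraph.compl_adj ..).2 ⟨?_, hind _ hcQ _ (hmem i).1⟩
    rintro rfl
    exact hcf (Finset.mem_image_of_mem _ (Finset.mem_univ i))
  · exact fun i => (SimpleGraph.compl_adj ..).2 ⟨hne _ _, fun h => (hmem i).2.1 h.symm⟩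
  · refine fun i => (SimpleGraph.compl_adj ..).2 ⟨(hne _ _).symm, ?_⟩
    have := (hmem (finRotate m i)).2.2
    rwa [Equiv.symm_apply_apply] at this

/-! ### Depth-first search. -/

/-- In a depth-first search, `T` holds the finished vertices and `l` the current path with its tip
at the head. A vertex is finished only when it has no unvisited neighbour, so `T` sends no edges to
unvisited vertices. Pushing and popping each raise `2 * T.card + l.length` by one. -/
theorem exists_card_eq_forall_not_adj {V : Type*} [Fintype V] [DecidableEq V] (G : SimpleGraph V)
    {p t : ℕ} (hp : ∀ l : List V, l.Nodup → l.IsChain G.Adj → l.length ≤ p)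
    (ht : t ≤ Fintype.card V) :
    ∃ S T : Finset V, Disjoint S T ∧ T.card = t ∧ Fintype.card V ≤ S.card + t + p ∧
      ∀ a ∈ T, ∀ b ∈ S, ¬ G.Adj a b := by
  have main : ∀ k : ℕ, ∃ (T : Finset V) (l : List V), l.Nodup ∧ l.IsChain G.Adj ∧
      (∀ x ∈ l, x ∉ T) ∧ (∀ a ∈ T, ∀ b, b ∉ T → b ∉ l → ¬ G.Adj a b) ∧
      (T.card = t ∨ T.card < t ∧ 2 * T.card + l.length = k) := by
    intro k
    induction k with
    | zero =>
      refine ⟨∅, [], by simp, by simp, by simp, by simp, ?_⟩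
      simp
      omega
    | succ k ih =>
      obtain ⟨T, l, hnd, hch, hT, hna, h | ⟨hlt, hk⟩⟩ := ih
      · exact ⟨T, l, hnd, hch, hT, hna, .inl h⟩
      cases l with
      | nil =>
        obtain ⟨v, -, hv⟩ := Finset.exists_mem_notMem_of_card_lt_card
          (s := T) (t := Finset.univ) (by rw [Finset.card_univ]; omega)
        refine ⟨T, [v], by simp, by simp, by simpa using hv, ?_, .inr ⟨hlt, ?_⟩⟩
        · exact fun a ha b hb _ => hna a ha b hb (by simp)
        · simp at hk ⊢; omega
      | cons v l =>
        by_cases hex : ∃ w, w ∉ T ∧ w ∉ v :: l ∧ G.Adj w v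
        · obtain ⟨w, hwT, hwl, hw⟩ := hex
          refine ⟨T, w :: v :: l, List.nodup_cons.2 ⟨hwl, hnd⟩, List.isChain_cons_cons.2 ⟨hw, hch⟩,
            ?_, ?_, .inr ⟨hlt, ?_⟩⟩
          · intro x hx
            rcases List.mem_cons.1 hx with rfl | hx
            exacts [hwT, hT x hx]
          · exact fun a ha b hb hb' => hna a ha b hb (fun h => hb' (List.mem_cons_of_mem _ h))
          · simp at hk ⊢; omega
        · push Not at hex
          have hvT : v ∉ T := hT v (by simp)
          refine ⟨insert v T, l, hnd.of_cons, hch.tail, ?_, ?_, ?_⟩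
          · intro x hx hx'
            rcases Finset.mem_insert.1 hx' with rfl | hx'
            · exact (List.nodup_cons.1 hnd).1 hx
            · exact hT x (by simp [hx]) hx'
          · intro a ha b hb hbl
            rw [Finset.mem_insert, not_or] at hb
            have hbl' : b ∉ v :: l := by simp [hb.1, hbl]
            rcases Finset.mem_insert.1 ha with rfl | ha
            · exact fun h => hex b hb.2 hbl' h.symm
            · exact hna a ha b hb.2 hbl'
          · rw [Finset.card_insert_of_notMem hvT]
            simp at hk
            omega
  -- With this many steps, `T.card < t` would force `l.length > p`.
  obtain ⟨T, l, hnd, hch, hT, hna, h⟩ := main (2 * t + p + 1)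
  have hl := hp l hnd hch
  have hcard : T.card = t := by omega
  refine ⟨Finset.univ \ (T ∪ l.toFinset), T, ?_, hcard, ?_, ?_⟩
  · exact Finset.disjoint_left.2 fun x hx hxT => by simp [hxT] at hx
  · have h1 := Finset.le_card_sdiff (T ∪ l.toFinset) Finset.univ
    have h2 := Finset.card_union_le T l.toFinset
    have h3 := l.toFinset_card_le
    rw [Finset.card_univ] at h1
    omega
  · intro a ha b hb
    simp at hb
    exact hna a ha b hb.1 hb.2

/-! ### Rotations of a longest path. -/

section LongestPath

variable {V : Type*} {G : SimpleGraph V} {l : List V}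

/-- The rotated path follows `l` to position `c - 1`, detours through `u`, runs back from `e - 1` to
`c`, and rejoins `l` at `e` by way of `w`. It is applied with `w` empty or a single outside vertex.
-/
theorem isChain_take_append_append_drop (hch : l.IsChain G.Adj) {c e : ℕ} (hce : c < e)
    (hel : e < l.length) {u : V} {w : List V} (hw : w.IsChain G.Adj)
    (hc : c = 0 ∨ G.Adj u l[c - 1]) (he : G.Adj u l[e - 1])
    (hcw : ∀ y ∈ (w ++ l.drop e).head?, G.Adj l[c] y)
    (hwe : ∀ x ∈ w.getLast?, G.Adj x l[e]) :
    (l.take c ++ (u :: (((l.drop c).take (e - c)).reverse ++ (w ++ l.drop e)))).IsChain G.Adj := by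
  have hS : ((l.drop c).take (e - c)).head? = some l[c] := by
    rw [List.head?_take, if_neg (by omega), List.head?_drop, List.getElem?_eq_getElem]
  have hS' : ((l.drop c).take (e - c)).getLast? = some l[e - 1] := by
    rw [List.getLast?_take, if_neg (by omega), List.getElem?_drop,
      List.getElem?_eq_getElem (by omega)]
    simp [show c + (e - c - 1) = e - 1 by omega]
  have hB : (l.drop e).head? = some l[e] := by
    rw [List.head?_drop, List.getElem?_eq_getElem]
  have hright : (((l.drop c).take (e - c)).reverse ++ (w ++ l.drop e)).IsChain G.Adj := by
    refine List.isChain_append.2 ⟨?_, List.isChain_append.2 ⟨hw, hch.drop e, ?_⟩, ?_⟩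
    · rw [List.isChain_reverse]
      exact ((hch.drop c).take _).imp fun _ _ h => h.symm
    · rw [hB]
      simpa using hwe
    · rw [List.getLast?_reverse, hS]
      simpa using hcw
  refine List.isChain_append.2 ⟨hch.take c, List.isChain_cons.2 ⟨?_, hright⟩, ?_⟩
  · rw [List.head?_append, List.head?_reverse, hS']
    simpa using he
  · rcases hc with rfl | hc
    · simp
    · rw [List.getLast?_take]
      split_ifs with h0
      · simp
      · rw [List.getElem?_eq_getElem (by omega)]
        simpa using hc.symm

theorem perm_take_append_append_drop {c e : ℕ} (hce : c < e) (u : V) (w : List V) :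
    (l.take c ++ (u :: (((l.drop c).take (e - c)).reverse ++ (w ++ l.drop e)))).Perm
      (u :: (w ++ l)) := by
  classical
  have hl : l = l.take c ++ ((l.drop c).take (e - c) ++ l.drop e) := by
    conv_lhs => rw [← List.take_append_drop c l, ← List.take_append_drop (e - c) (l.drop c)]
    rw [List.drop_drop, show c + (e - c) = e by omega]
  rw [List.perm_iff_count]
  intro a
  conv_rhs => rw [hl]
  simp only [List.count_append, List.count_cons, List.count_reverse]
  omega

/-- A path, given as its list of vertices, that is at least as long as any other path of `G`. -/
structure IsLongestPath (G : SimpleGraph V) (l : List V) : Prop where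
  nodup : l.Nodup
  isChain : l.IsChain G.Adj
  length_le : ∀ l' : List V, l'.Nodup → l'.IsChain G.Adj → l'.length ≤ l.length

namespace IsLongestPath

theorem not_adj_head (hl : IsLongestPath G l) {u : V} (hu : u ∉ l) (h0 : 0 < l.length) :
    ¬ G.Adj u l[0] := by
  intro h
  have := hl.length_le (u :: l) (List.nodup_cons.2 ⟨hu, hl.nodup⟩)
    (List.isChain_cons.2 ⟨by
      rw [List.head?_eq_getElem?, List.getElem?_eq_getElem h0]; simpa using h, hl.isChain⟩)
  simp at this

theorem not_adj_last (hl : IsLongestPath G l) {u : V} (hu : u ∉ l) (h0 : l.length - 1 < l.length) :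
    ¬ G.Adj u l[l.length - 1] := by
  intro h
  have := hl.length_le (l ++ [u])
    (by rw [List.nodup_append_comm]; exact List.nodup_cons.2 ⟨hu, hl.nodup⟩)
    (List.isChain_append.2 ⟨hl.isChain, by simp, by
      rw [List.getLast?_eq_getElem?, List.getElem?_eq_getElem h0]; simpa using h.symm⟩)
  simp at this

/-- Otherwise `u` could be inserted just before `l[c]`. -/
theorem not_adj_getElem (hl : IsLongestPath G l) {u : V} (hu : u ∉ l) {c : ℕ} (hc : c < l.length)
    (huc : c = 0 ∨ G.Adj u l[c - 1]) : ¬ G.Adj u l[c] := by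
  intro h
  have hperm : (l.take c ++ u :: l.drop c).Perm (u :: l) := by
    refine List.perm_middle.trans ?_
    rw [List.take_append_drop]
  have hch : (l.take c ++ u :: l.drop c).IsChain G.Adj := by
    refine List.isChain_append.2 ⟨hl.isChain.take c, List.isChain_cons.2 ⟨?_, hl.isChain.drop c⟩, ?_⟩
    · rw [List.head?_drop, List.getElem?_eq_getElem hc]
      simpa using h
    · rcases huc with rfl | huc
      · simp
      · rw [List.getLast?_take]
        split_ifs with h0
        · simp
        · rw [List.getElem?_eq_getElem (by omega)]
          simpa using huc.symm
  have := hl.length_le _ (hperm.nodup_iff.2 (List.nodup_cons.2 ⟨hu, hl.nodup⟩)) hch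
  rw [hperm.length_eq] at this
  simp at this

/-- The vertices following neighbours of an outside vertex `u`, and the first vertex of the path,
are pairwise nonadjacent. -/
theorem not_adj_of_lt (hl : IsLongestPath G l) {u : V} (hu : u ∉ l) {c e : ℕ} (hce : c < e)
    (he : e < l.length) (huc : c = 0 ∨ G.Adj u l[c - 1]) (hue : e = 0 ∨ G.Adj u l[e - 1]) :
    ¬ G.Adj l[c] l[e] := by
  intro h
  have hperm := perm_take_append_append_drop (l := l) hce u []
  have := hl.length_le _ (hperm.nodup_iff.2 (List.nodup_cons.2 ⟨hu, hl.nodup⟩))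
    (isChain_take_append_append_drop hl.isChain hce he (by simp) huc
      (hue.resolve_left (by omega)) (by
        rw [List.nil_append, List.head?_drop, List.getElem?_eq_getElem he]; simpa using h) (by simp))
  rw [hperm.length_eq] at this
  simp at this

/-- Otherwise the rotation through `u`, closed up by `l[c], v, l[e]`, would be two vertices longer
than `l`. -/
theorem not_adj_and_adj (hl : IsLongestPath G l) {u v : V} (hu : u ∉ l) (hv : v ∉ l) (huv : u ≠ v)
    {c e : ℕ} (hce : c < e) (he : e < l.length) (huc : c = 0 ∨ G.Adj u l[c - 1])
    (hue : e = 0 ∨ G.Adj u l[e - 1]) : ¬ (G.Adj v l[c] ∧ G.Adj v l[e]) := by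
  rintro ⟨hvc, hve⟩
  have hperm := perm_take_append_append_drop (l := l) hce u [v]
  have := hl.length_le _ (hperm.nodup_iff.2 (by simp [hu, hv, huv, hl.nodup]))
    (isChain_take_append_append_drop hl.isChain hce he (by simp) huc
      (hue.resolve_left (by omega)) (by simpa using hvc.symm) (by simpa using hve))
  rw [hperm.length_eq] at this
  simp at this

open Classical in
/-- An outside vertex with many neighbours on a longest path yields a large independent set in
which every other outside vertex has at most one neighbour. -/
theorem exists_independent (hl : IsLongestPath G l) {u : V} (hu : u ∉ l) (h0 : 0 < l.length) :
    ∃ Q : Finset V, (∀ x ∈ Q, x ∈ l) ∧ (l.toFinset.filter (G.Adj u)).card + 1 ≤ Q.card ∧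
      (∀ x ∈ Q, ∀ y ∈ Q, ¬ G.Adj x y) ∧
      ∀ v, v ∉ l → (Q.filter (G.Adj v)).card ≤ 1 := by
  let J : Finset (Fin l.length) := Finset.univ.filter fun c => c.val = 0 ∨ G.Adj u l[c.val - 1]
  let E : Finset (Fin l.length) := Finset.univ.filter fun c => G.Adj u l[c]
  have hinj : Function.Injective fun c : Fin l.length => l[c] :=
    List.nodup_iff_injective_get.1 hl.nodup
  have hJ : ∀ c ∈ J, c.val = 0 ∨ G.Adj u l[c.val - 1] := fun c hc => by simpa [J] using hc
  have hE : (l.toFinset.filter (G.Adj u)).card ≤ E.card := by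
    refine (Finset.card_le_card ?_).trans (Finset.card_image_le (s := E) (f := fun c => l[c]))
    intro x hx
    rw [Finset.mem_filter, List.mem_toFinset] at hx
    obtain ⟨i, hi, rfl⟩ := List.getElem_of_mem hx.1
    exact Finset.mem_image.2 ⟨⟨i, hi⟩, by simpa [E] using hx.2, rfl⟩
  have hEJ : E.card + 1 ≤ J.card := by
    have h0J : (⟨0, h0⟩ : Fin l.length) ∈ J := by simp [J]
    rw [← Finset.card_erase_add_one h0J, add_le_add_iff_right]
    -- Shifting by one maps `E` injectively into `J` without `0`. It stays in range because the last
    -- vertex of `l` is not a neighbour of `u`, so the `else` branch below is never taken.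
    have hlt : ∀ c ∈ E, c.val + 1 < l.length := by
      intro c hc
      by_contra hcon
      have hc' : c.val = l.length - 1 := by have := c.isLt; omega
      apply hl.not_adj_last hu (by omega)
      simpa [E, hc'] using hc
    refine Finset.card_le_card_of_injOn
      (fun c => if h : c.val + 1 < l.length then ⟨c.val + 1, h⟩ else c) ?_ ?_
    · intro c hc
      simp only [Finset.mem_coe, hlt c hc, dif_pos, Finset.mem_erase]
      refine ⟨by simp [Fin.ext_iff], ?_⟩
      simpa [J, E] using hc
    · intro c hc d hd hcd
      simpa only [hlt c hc, hlt d hd, dif_pos, Fin.mk.injEq, add_left_inj, Fin.val_inj] using hcd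
  refine ⟨J.image fun c => l[c], ?_, ?_, ?_, ?_⟩
  · intro x hx
    obtain ⟨c, -, rfl⟩ := Finset.mem_image.1 hx
    exact List.getElem_mem _
  · rw [Finset.card_image_of_injective _ hinj]
    omega
  · intro x hx y hy
    obtain ⟨c, hc, rfl⟩ := Finset.mem_image.1 hx
    obtain ⟨e, he, rfl⟩ := Finset.mem_image.1 hy
    rcases lt_trichotomy c.val e.val with h | h | h
    · exact hl.not_adj_of_lt hu h e.isLt (hJ c hc) (hJ e he)
    · rw [Fin.ext h]
      exact G.irrefl
    · exact fun hadj => hl.not_adj_of_lt hu h c.isLt (hJ e he) (hJ c hc) hadj.symm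
  · intro v hv
    rw [Finset.card_le_one]
    intro x hx y hy
    rw [Finset.mem_filter] at hx hy
    obtain ⟨hx, hvx⟩ := hx
    obtain ⟨hy, hvy⟩ := hy
    obtain ⟨c, hc, rfl⟩ := Finset.mem_image.1 hx
    obtain ⟨e, he, rfl⟩ := Finset.mem_image.1 hy
    by_cases huv : u = v
    · subst huv
      exact absurd hvx (hl.not_adj_getElem hu c.isLt (hJ c hc))
    · rcases lt_trichotomy c.val e.val with h | h | h
      · exact absurd ⟨hvx, hvy⟩ (hl.not_adj_and_adj hu hv huv h e.isLt (hJ c hc) (hJ e he))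
      · rw [Fin.ext h]
      · exact absurd ⟨hvy, hvx⟩ (hl.not_adj_and_adj hu hv huv h c.isLt (hJ e he) (hJ c hc))

end IsLongestPath

end LongestPath

/-! ### Upper bound. -/

theorem exists_isLongestPath {V : Type*} [Fintype V] (G : SimpleGraph V) :
    ∃ l, IsLongestPath G l := by
  classical
  let P : ℕ → Prop := fun k => ∃ l : List V, l.Nodup ∧ l.IsChain G.Adj ∧ l.length = k
  have hle : ∀ l : List V, l.Nodup → l.length ≤ Fintype.card V := fun l hl => hl.length_le_card
  have h0 : P 0 := ⟨[], by simp, by simp, rfl⟩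
  obtain ⟨l, hnd, hch, hlen⟩ := Nat.findGreatest_spec (Nat.zero_le (Fintype.card V)) h0
  refine ⟨l, hnd, hch, fun l' hnd' hch' => ?_⟩
  rw [hlen]
  exact Nat.le_findGreatest (hle l' hnd') ⟨l', hnd', hch', rfl⟩

/-- A graph on `N + m - 1` vertices without a path on `N` vertices contains the Jahangir graph in
its complement. -/
theorem jahangirGraph_isContained_compl_of_forall_isChain {V : Type*} [Fintype V]
    (G : SimpleGraph V) {N m : ℕ} (hm : 1 ≤ m) (hN : 4 * m + 2 ≤ N)
    (hV : Fintype.card V = N + m - 1)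
    (hG : ∀ l : List V, l.Nodup → l.IsChain G.Adj → l.length ≠ N) :
    (jahangirGraph m).IsContained Gᶜ := by
  classical
  obtain ⟨l, hl⟩ := exists_isLongestPath G
  have hlN : l.length < N := by
    by_contra! h
    exact hG (l.take N) (hl.nodup.sublist (List.take_sublist N l)) (hl.isChain.take N) (by simpa)
  have hfew : ∀ s : Finset V, m ≤ s.card → ∃ u : Fin m → V, Function.Injective u ∧ ∀ i, u i ∈ s :=
    fun s hs => exists_injective_mem_of_card_le (fun _ => s) fun _ => hs
  -- Above `3 * m`, deleting the first vertex of `l` still leaves the `m + 2 * m` vertices needed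
  -- with `D = m`.
  rcases Nat.lt_or_ge (3 * m) l.length with hp | hp
  · have hcard : l.toFinset.card = l.length := List.toFinset_card_of_nodup hl.nodup
    have h0 : 0 < l.length := by omega
    obtain ⟨u, hu, hul⟩ := hfew (l.toFinset)ᶜ (by rw [Finset.card_compl]; omega)
    replace hul : ∀ i, u i ∉ l := fun i => by simpa using hul i
    by_cases hdeg : ∃ i, m + 1 ≤ (l.toFinset.filter (G.Adj (u i))).card
    · obtain ⟨i, hi⟩ := hdeg
      obtain ⟨Q, hQl, hQ, hind, hQv⟩ := hl.exists_independent (hul i) h0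
      exact jahangirGraph_isContained_compl_of_independent hu (fun j hj => hul j (hQl _ hj)) hind
        (fun j => by convert hQv _ (hul j)) (by omega)
    · push Not at hdeg
      have hmem : l[0] ∈ l := List.getElem_mem _
      refine jahangirGraph_isContained_compl_of_few_neighbors (c := l[0]) (D := m)
        (Q := l.toFinset.erase l[0]) hu ?_ (Finset.notMem_erase _ _) ?_ ?_ ?_
      · exact fun i hi => hul i (List.mem_toFinset.1 (Finset.mem_of_mem_erase hi))
      · exact fun i => ⟨fun h => hul i (h ▸ hmem), fun h => hl.not_adj_head (hul i) h0 h.symm⟩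
      · intro i
        refine (Finset.card_le_card ?_).trans (Nat.le_of_lt_succ (hdeg i))
        intro x
        simp only [Finset.mem_filter, Finset.mem_erase]
        tauto
      · rw [Finset.card_erase_of_mem (List.mem_toFinset.2 hmem), hcard]
        omega
  · obtain ⟨S, T, hST, hT, hS, hna⟩ := exists_card_eq_forall_not_adj G (t := m) hl.length_le
      (by omega)
    obtain ⟨u, hu, huT⟩ := hfew T hT.ge
    obtain ⟨c, hc⟩ : S.Nonempty := Finset.card_pos.1 (by omega)
    have huS : ∀ i, u i ∉ S := fun i => Finset.disjoint_right.1 hST (huT i)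
    refine jahangirGraph_isContained_compl_of_few_neighbors (c := c) (D := 0)
      (Q := S.erase c) hu ?_ (Finset.notMem_erase _ _) ?_ ?_ ?_
    · exact fun i hi => huS i (Finset.mem_of_mem_erase hi)
    · exact fun i => ⟨fun h => huS i (h ▸ hc), fun h => hna _ (huT i) _ hc h.symm⟩
    · intro i
      rw [Nat.le_zero, Finset.card_eq_zero, Finset.filter_eq_empty_iff]
      exact fun x hx => hna _ (huT i) _ (Finset.mem_of_mem_erase hx)
    · rw [Finset.card_erase_of_mem hc]
      omega

/-- A path on `k * n` vertices contains `k` disjoint paths on `n` vertices. -/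
theorem disjointCopies_pathGraph_isContained {V : Type*} {G : SimpleGraph V} {k n : ℕ} {l : List V}
    (hnd : l.Nodup) (hch : l.IsChain G.Adj) (hlen : l.length = k * n) :
    (disjointCopies k (SimpleGraph.pathGraph n)).IsContained G := by
  let idx : Fin k × Fin n → Fin l.length := fun a => (finProdFinEquiv a).cast hlen.symm
  have hidx : Function.Injective idx :=
    (Fin.cast_injective _).comp finProdFinEquiv.injective
  have hval : ∀ a, (idx a : ℕ) = a.2 + n * a.1 := fun a => rfl
  have hstep : ∀ a b : Fin k × Fin n, a.1 = b.1 → (a.2 : ℕ) + 1 = b.2 →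
      G.Adj l[idx a] l[idx b] := by
    intro a b h1 h2
    have h3 : (idx b : ℕ) = idx a + 1 := by rw [hval, hval, h1]; omega
    have h4 := List.isChain_iff_getElem.1 hch (idx a) (by have := (idx b).isLt; omega)
    simpa [h3] using h4
  refine ⟨⟨⟨fun a => l[idx a], ?_⟩, (List.nodup_iff_injective_get.1 hnd).comp hidx⟩⟩
  rintro a b ⟨h1, h2⟩
  rcases SimpleGraph.pathGraph_adj.1 h2 with h | h
  · exact hstep a b h1 h
  · exact (hstep b a h1.symm h).symm

/-! ### Lower bound. -/

/-- The complete graph on the first `s` of `r` vertices, together with `r - s` isolated vertices. -/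
def initialClique (r s : ℕ) : SimpleGraph (Fin r) where
  Adj i j := i ≠ j ∧ i.val < s ∧ j.val < s
  symm.symm _ _ h := ⟨h.1.symm, h.2.2, h.2.1⟩
  loopless.irrefl _ h := h.1 rfl

theorem not_disjointCopies_isContained_initialClique {k n r s : ℕ} (hn : 2 ≤ n) (hs : s < k * n) :
    ¬ (disjointCopies k (SimpleGraph.pathGraph n)).IsContained (initialClique r s) := by
  rintro ⟨φ⟩
  -- As `n ≥ 2`, no vertex of a path is isolated, so every image lies in the clique.
  have hlt : ∀ a, (φ.toHom a).val < s := by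
    rintro ⟨i, j⟩
    have hj := j.isLt
    obtain ⟨j', hj'⟩ : ∃ j', (SimpleGraph.pathGraph n).Adj j j' := by
      by_cases h : j.val + 1 < n
      · exact ⟨⟨j + 1, h⟩, SimpleGraph.pathGraph_adj.2 (.inl rfl)⟩
      · exact ⟨⟨j - 1, by omega⟩, SimpleGraph.pathGraph_adj.2 (.inr (by simp; omega))⟩
    have : (disjointCopies k (SimpleGraph.pathGraph n)).Adj (i, j) (i, j') := ⟨rfl, hj'⟩
    exact (φ.toHom.map_adj this).2.1
  have := Fintype.card_le_of_injective (fun a => (⟨φ.toHom a, hlt a⟩ : Fin s)) (by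
    intro a b hab
    rw [Fin.mk.injEq] at hab
    exact φ.injective' (Fin.ext hab))
  simp at this
  omega

theorem not_jahangirGraph_isContained_compl_initialClique {m r s : ℕ} (hm : 2 ≤ m)
    (hr : r < s + m) : ¬ (jahangirGraph m).IsContained (initialClique r s)ᶜ := by
  rintro ⟨φ⟩
  -- The edges from `2 * t` to `2 * t + 1` form a perfect matching of the cycle, and each needs an
  -- endpoint outside the clique.
  have key : ∀ t : Fin m, ∃ j : Fin (2 * m), j.val / 2 = t ∧ s ≤ (φ.toHom (some j)).val := by
    intro t
    have ht := t.isLt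
    let a : Fin (2 * m) := ⟨2 * t, by omega⟩
    let b : Fin (2 * m) := ⟨2 * t + 1, by omega⟩
    have hab : (jahangirGraph m).Adj (some a) (some b) := by
      refine SimpleGraph.cycleGraph_adj'.2 (.inr ?_)
      rw [Fin.sub_val_of_le (by simp [a, b, Fin.le_def])]
      simp [a, b]
    have h := (φ.toHom.map_adj hab)
    rw [SimpleGraph.compl_adj] at h
    by_cases ha : s ≤ (φ.toHom (some a)).val
    · exact ⟨a, by simp [a], ha⟩
    · refine ⟨b, by simp only [b]; omega, ?_⟩
      by_contra hb
      exact h.2 ⟨h.1, not_le.1 ha, not_le.1 hb⟩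
  choose j hj hjs using key
  have := Fintype.card_le_of_injective
    (fun t => (⟨(φ.toHom (some (j t))).val - s, by
      have := (φ.toHom (some (j t))).isLt
      have := hjs t
      omega⟩ : Fin (r - s))) (by
    intro t t' h
    rw [Fin.mk.injEq] at h
    have h1 := hjs t
    have h2 := hjs t'
    have h3 : j t = j t' := Option.some_injective _ (φ.injective' (Fin.ext (by omega)))
    ext
    rw [← hj t, ← hj t', h3])
  simp at this
  omega

theorem theorem3 (k n m : ℕ) (hk : 2 ≤ k)
    (h : ((m = 3 ∨ m = 4 ∨ m = 5) ∧ 2 * m + 1 ≤ n) ∨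
      (6 ≤ m ∧ (4 * m - 1) * (m - 1) + 1 ≤ n)) :
    IsRamseyNumber (disjointCopies k (SimpleGraph.pathGraph n)) (jahangirGraph m)
      (k * n + m - 1) := by
  have hmn : 3 ≤ m ∧ 2 * m + 1 ≤ n := by
    rcases h with ⟨h, hn⟩ | ⟨h, hn⟩
    · omega
    · have : (4 * m - 1) * 1 ≤ (4 * m - 1) * (m - 1) := Nat.mul_le_mul_left _ (by omega)
      omega
  obtain ⟨hm, hn⟩ := hmn
  have hkn : 2 * n ≤ k * n := Nat.mul_le_mul_right n hk
  refine ⟨fun F => ?_, fun r hr => ?_⟩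
  · by_cases hF : ∃ l : List (Fin (k * n + m - 1)), l.Nodup ∧ l.IsChain F.Adj ∧ l.length = k * n
    · obtain ⟨l, hnd, hch, hlen⟩ := hF
      exact .inl (disjointCopies_pathGraph_isContained hnd hch hlen)
    · push Not at hF
      exact .inr (jahangirGraph_isContained_compl_of_forall_isChain F (by omega) (by omega)
        (by simp) hF)
  · by_contra hlt
    -- Since `r ≤ k * n + m - 2`, at most `m - 1` vertices lie outside the clique.
    rcases hr (initialClique r (k * n - 1)) with h | h
    · exact not_disjointCopies_isContained_initialClique (by omega) (by omega) h
    · exact not_jahangirGraph_isContained_compl_initialClique (by omega) (by omega) h
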